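/- Let $k$ be a field of characteristic $0$. Let $\mathrm{BiCom}$ be the binary quadratic operad over $k$ of bicommutative algebras, i.e. of (not necessarily associative or unital) algebras with one bilinear operation satisfying $(ab)c=(ac)b$ and $a(bc)=b(ac)$. For a binary quadratic operad $P$ generated by one operation without symmetry, with space of relations $R$ in the $12$-dimensional arity-three component of the magmatic operad, let $P^!$ be the dual operad: it is generated by one operation without symmetry, and its space of relations is the orthogonal complement of $R$ with respect to the pairing for which distinct tree monomials are orthogonal, $\langle (x_{\sigma(1)}x_{\sigma(2)})x_{\sigma(3)},(x_{\sigma(1)}x_{\sigma(2)})x_{\sigma(3)}\rangle=\operatorname{sgn}\sigma$ and $\langle x_{\sigma(1)}(x_{\sigma(2)}x_{\sigma(3)}),x_{\sigma(1)}(x_{\sigma(2)}x_{\sigma(3)})\rangle=-\operatorname{sgn}\sigma$. (Equivalently, the relations of $P^!$ are the identities on $S$ that make the commutator $[a\otimes u,b\otimes v]=ab\otimes uv-ba\otimes vu$ on $S\otimes U$ a Lie bracket for every $P$-algebra $U$.) Formal distributions $a(z),b(z)\in A[[z,z^{-1}]]$ over an algebra $A$ are mutually local if there is $N\ge 0$ with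 $(w-z)^N a(w)b(z)=0$ and $(w-z)^N b(w)a(z)=0$. For an integer $n\ge 0$ let $(a_{(n)}b)(z)=\operatorname{Res}_{w}(w-z)^n a(w)b(z)$, where $\operatorname{Res}_w$ is the coefficient of $w^{-1}$. An operad $P$ satisfies the Dong property if for every $P$-algebra $A$, all pairwise mutually local formal distributions $a(z),b(z),c(z)$ over $A$ and every $n\ge 0$, the distributions $(a_{(n)}b)(z)$ and $c(z)$ are mutually local. Then: 1. $\mathrm{BiCom}$ is self-dual: $\mathrm{BiCom}^!$ is defined by the same identities $(ab)c=(ac)b$ and $a(bc)=b(ac)$ as $\mathrm{BiCom}$, and $\mathrm{BiCom}^!\cong\mathrm{BiCom}$ as symmetric operads. 2. For every set $X$ and pairwise distinct $a,b,c\in X$, the monomials $(ab)c$, $(ba)c$, $c(ab)$ and $c(ba)$ are linearly independent in the free algebra $\mathrm{BiCom}^!\langle X\rangle$. 3. $\mathrm{BiCom}$ satisfies the Dong property. -/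

import Mathlib

universe u v w

noncomputable section

/-! ### Binary quadratic operads with one generating operation -/

/-- The arity-three component of the free (magmatic) operad on one binary operation without
symmetry, in coordinates with respect to its twelve tree monomials: `r.1 σ` is the coefficient of
`(x_{σ 0} x_{σ 1}) x_{σ 2}` and `r.2 σ` is the coefficient of `x_{σ 0} (x_{σ 1} x_{σ 2})`. -/
abbrev Mag3 (k : Type u) : Type u := (Equiv.Perm (Fin 3) → k) × (Equiv.Perm (Fin 3) → k)

namespace Mag3

variable {k : Type u} [Field k]

/-- The monomial `(x_{σ 0} x_{σ 1}) x_{σ 2}`. -/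
def leftMonomial (σ : Equiv.Perm (Fin 3)) : Mag3 k := (Pi.single σ 1, 0)

/-- The monomial `x_{σ 0} (x_{σ 1} x_{σ 2})`. -/
def rightMonomial (σ : Equiv.Perm (Fin 3)) : Mag3 k := (0, Pi.single σ 1)

/-- The action of the symmetric group: `τ` renames each variable `x_i` to `x_{τ i}`. -/
def relabel (τ : Equiv.Perm (Fin 3)) : Mag3 k →ₗ[k] Mag3 k where
  toFun r := (fun σ => r.1 (τ⁻¹ * σ), fun σ => r.2 (τ⁻¹ * σ))
  map_add' _ _ := rfl
  map_smul' _ _ := rfl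

/-- The value of a multilinear polynomial of degree three at `x_i = a i` in an algebra. -/
def eval {A : Type v} [NonUnitalNonAssocRing A] [Module k A] (a : Fin 3 → A) (r : Mag3 k) : A :=
  ∑ σ : Equiv.Perm (Fin 3),
    (r.1 σ • ((a (σ 0) * a (σ 1)) * a (σ 2)) + r.2 σ • (a (σ 0) * (a (σ 1) * a (σ 2))))

/-- The pairing between the arity-three components of the free operads on `E^∨ = E^* ⊗ sgn` and on
`E`, where `E` is the regular representation of `S_2`. With the basis `x₁x₂, x₂x₁` of `E`, the dual
basis of `E^∨` is `y₁y₂, -y₂y₁`. Tree monomials of different kinds are orthogonal,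
`⟨(y_{σ 0} y_{σ 1}) y_{σ 2}, (x_{σ 0} x_{σ 1}) x_{σ 2}⟩ = sgn σ` and
`⟨y_{σ 0} (y_{σ 1} y_{σ 2}), x_{σ 0} (x_{σ 1} x_{σ 2})⟩ = - sgn σ`. -/
def pairing (q r : Mag3 k) : k :=
  ∑ σ : Equiv.Perm (Fin 3), ((Equiv.Perm.sign σ : ℤ) : k) * (q.1 σ * r.1 σ - q.2 σ * r.2 σ)

theorem relabel_leftMonomial (τ σ : Equiv.Perm (Fin 3)) :
    relabel τ (leftMonomial σ : Mag3 k) = leftMonomial (τ * σ) := by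
  refine Prod.ext (funext fun ρ => ?_) rfl
  simp [relabel, leftMonomial, Pi.single_apply, inv_mul_eq_iff_eq_mul]

theorem relabel_rightMonomial (τ σ : Equiv.Perm (Fin 3)) :
    relabel τ (rightMonomial σ : Mag3 k) = rightMonomial (τ * σ) := by
  refine Prod.ext rfl (funext fun ρ => ?_)
  simp [relabel, rightMonomial, Pi.single_apply, inv_mul_eq_iff_eq_mul]

theorem pairing_relabel (τ : Equiv.Perm (Fin 3)) (q r : Mag3 k) :
    pairing (relabel τ q) r = ((Equiv.Perm.sign τ : ℤ) : k) * pairing q (relabel τ⁻¹ r) := by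
  unfold pairing
  rw [Finset.mul_sum, ← Equiv.sum_comp (Equiv.mulLeft τ)]
  refine Finset.sum_congr rfl fun σ _ => ?_
  simp [relabel, mul_assoc]

end Mag3

/-- A binary quadratic operad over `k` generated by one operation without symmetry: the quotient
of the magmatic operad by the operadic ideal generated by an `S_3`-submodule `rel` of its
arity-three component. -/
@[ext]
structure BinaryQuadraticOperad (k : Type u) [Field k] where
  rel : Submodule k (Mag3 k)
  relabel_mem : ∀ (τ : Equiv.Perm (Fin 3)) (r : Mag3 k), r ∈ rel → Mag3.relabel τ r ∈ rel

/-- The operad `BiCom` of bicommutative algebras: `(ab)c = (ac)b` and `a(bc) = b(ac)`. -/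
def biCom (k : Type u) [Field k] : BinaryQuadraticOperad k where
  rel := Submodule.span k
    (Set.range (fun σ : Equiv.Perm (Fin 3) =>
        Mag3.leftMonomial σ - Mag3.leftMonomial (σ * Equiv.swap 1 2)) ∪
      Set.range (fun σ : Equiv.Perm (Fin 3) =>
        Mag3.rightMonomial σ - Mag3.rightMonomial (σ * Equiv.swap 0 1)))
  relabel_mem τ r hr := by
    induction hr using Submodule.span_induction with
    | mem x hx =>
      apply Submodule.subset_span
      rcases hx with ⟨σ, rfl⟩ | ⟨σ, rfl⟩
      · exact Or.inl ⟨τ * σ, by simp [Mag3.relabel_leftMonomial, mul_assoc]⟩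
      · exact Or.inr ⟨τ * σ, by simp [Mag3.relabel_rightMonomial, mul_assoc]⟩
    | zero => rw [map_zero]; exact Submodule.zero_mem _
    | add x y _ _ hx hy => rw [map_add]; exact Submodule.add_mem _ hx hy
    | smul c x _ hx => rw [map_smul]; exact Submodule.smul_mem _ c hx

namespace BinaryQuadraticOperad

variable {k : Type u} [Field k] (P : BinaryQuadraticOperad k)

/-- The (Koszul) dual operad `P^!`: it is generated by one operation without symmetry, and its
quadratic relations are the orthogonal complement of those of `P`. Equivalently, its relations are
the identities on `S` which make the commutator `[a ⊗ u, b ⊗ v] = ab ⊗ uv - ba ⊗ vu` on `S ⊗ U`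
satisfy the Jacobi identity for all `P`-algebras `U`. -/
def dual : BinaryQuadraticOperad k where
  rel :=
    { carrier := {q | ∀ r ∈ P.rel, Mag3.pairing q r = 0}
      zero_mem' := fun r _ => by simp [Mag3.pairing]
      add_mem' := fun {p q} hp hq r hr => by
        have h : Mag3.pairing (p + q) r = Mag3.pairing p r + Mag3.pairing q r := by
          unfold Mag3.pairing
          rw [← Finset.sum_add_distrib]
          refine Finset.sum_congr rfl fun σ _ => ?_
          simp only [Prod.fst_add, Prod.snd_add, Pi.add_apply]
          ring
        rw [h, hp r hr, hq r hr, add_zero]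
      smul_mem' := fun c q hq r hr => by
        have h : Mag3.pairing (c • q) r = c * Mag3.pairing q r := by
          unfold Mag3.pairing
          rw [Finset.mul_sum]
          refine Finset.sum_congr rfl fun σ _ => ?_
          simp only [Prod.smul_fst, Prod.smul_snd, Pi.smul_apply, smul_eq_mul]
          ring
        rw [h, hq r hr, mul_zero] }
  relabel_mem τ q hq r hr := by
    rw [Mag3.pairing_relabel, hq _ (P.relabel_mem τ⁻¹ r hr), mul_zero]

/-- `A` is an algebra over the operad `P`, i.e. belongs to the variety defined by its identities. -/
def IsAlgebra (A : Type v) [NonUnitalNonAssocRing A] [Module k A] : Prop :=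
  ∀ r ∈ P.rel, ∀ a : Fin 3 → A, Mag3.eval a r = 0

/-! ### Free algebras -/

/-- The ideal of the free nonassociative algebra generated by all values of the identities of `P`:
the smallest subspace that contains them and is closed under multiplication from both sides. -/
def idealOfIdentities (X : Type v) : Submodule k (FreeNonUnitalNonAssocAlgebra k X) :=
  sInf {I | (∀ r ∈ P.rel, ∀ a : Fin 3 → FreeNonUnitalNonAssocAlgebra k X, Mag3.eval a r ∈ I) ∧
    ∀ x, ∀ y ∈ I, x * y ∈ I ∧ y * x ∈ I}

theorem eval_mem_ideal {X : Type v} {r : Mag3 k} (hr : r ∈ P.rel)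
    (a : Fin 3 → FreeNonUnitalNonAssocAlgebra k X) : Mag3.eval a r ∈ P.idealOfIdentities X :=
  (Submodule.mem_sInf).2 fun _ hI => hI.1 r hr a

theorem mul_mem_ideal_left {X : Type v} (x : FreeNonUnitalNonAssocAlgebra k X)
    {y : FreeNonUnitalNonAssocAlgebra k X} (hy : y ∈ P.idealOfIdentities X) :
    x * y ∈ P.idealOfIdentities X :=
  (Submodule.mem_sInf).2 fun I hI => (hI.2 x y ((Submodule.mem_sInf).1 hy I hI)).1

theorem mul_mem_ideal_right {X : Type v} {y : FreeNonUnitalNonAssocAlgebra k X}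
    (hy : y ∈ P.idealOfIdentities X) (x : FreeNonUnitalNonAssocAlgebra k X) :
    y * x ∈ P.idealOfIdentities X :=
  (Submodule.mem_sInf).2 fun I hI => (hI.2 x y ((Submodule.mem_sInf).1 hy I hI)).2

/-- The free `P`-algebra `P⟨X⟩` on a set `X`. -/
def FreeAlg (X : Type v) : Type (max u v) :=
  FreeNonUnitalNonAssocAlgebra k X ⧸ P.idealOfIdentities X

namespace FreeAlg

variable {P} {X : Type v}

instance : AddCommGroup (P.FreeAlg X) :=
  inferInstanceAs (AddCommGroup (FreeNonUnitalNonAssocAlgebra k X ⧸ P.idealOfIdentities X))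

instance : Module k (P.FreeAlg X) :=
  inferInstanceAs (Module k (FreeNonUnitalNonAssocAlgebra k X ⧸ P.idealOfIdentities X))

/-- The quotient map. -/
def mk : FreeNonUnitalNonAssocAlgebra k X →ₗ[k] P.FreeAlg X :=
  (P.idealOfIdentities X).mkQ

theorem mk_surjective : Function.Surjective (mk : _ →ₗ[k] P.FreeAlg X) :=
  Submodule.mkQ_surjective _

theorem mk_eq_mk {x y : FreeNonUnitalNonAssocAlgebra k X} :
    (mk x : P.FreeAlg X) = mk y ↔ x - y ∈ P.idealOfIdentities X :=
  Submodule.Quotient.eq _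

instance : Mul (P.FreeAlg X) where
  mul := Quotient.map₂ (· * ·) (by
    intro a b hab c d hcd
    have h1 : a - b ∈ P.idealOfIdentities X := (Submodule.quotientRel_def _).1 hab
    have h2 : c - d ∈ P.idealOfIdentities X := (Submodule.quotientRel_def _).1 hcd
    refine (Submodule.quotientRel_def _).2 ?_
    have h3 : a * c - b * d = (a - b) * c + b * (c - d) := by
      rw [sub_mul, mul_sub]; abel
    rw [h3]
    exact Submodule.add_mem _ (P.mul_mem_ideal_right h1 c) (P.mul_mem_ideal_left b h2))

theorem mk_mul (x y : FreeNonUnitalNonAssocAlgebra k X) :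
    (mk (x * y) : P.FreeAlg X) = mk x * mk y := rfl

instance : NonUnitalNonAssocRing (P.FreeAlg X) :=
  { (inferInstance : AddCommGroup (P.FreeAlg X)), (inferInstance : Mul (P.FreeAlg X)) with
    left_distrib := by
      intro a b c
      obtain ⟨a, rfl⟩ := mk_surjective a
      obtain ⟨b, rfl⟩ := mk_surjective b
      obtain ⟨c, rfl⟩ := mk_surjective c
      rw [← map_add, ← mk_mul, ← mk_mul, ← mk_mul, ← map_add, mul_add]
    right_distrib := by
      intro a b c
      obtain ⟨a, rfl⟩ := mk_surjective a
      obtain ⟨b, rfl⟩ := mk_surjective b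
      obtain ⟨c, rfl⟩ := mk_surjective c
      rw [← map_add, ← mk_mul, ← mk_mul, ← mk_mul, ← map_add, add_mul]
    zero_mul := by
      intro a
      obtain ⟨a, rfl⟩ := mk_surjective a
      rw [← map_zero (mk : _ →ₗ[k] P.FreeAlg X), ← mk_mul, zero_mul]
    mul_zero := by
      intro a
      obtain ⟨a, rfl⟩ := mk_surjective a
      rw [← map_zero (mk : _ →ₗ[k] P.FreeAlg X), ← mk_mul, mul_zero] }

instance : IsScalarTower k (P.FreeAlg X) (P.FreeAlg X) where
  smul_assoc c a b := by
    obtain ⟨a, rfl⟩ := mk_surjective a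
    obtain ⟨b, rfl⟩ := mk_surjective b
    rw [smul_eq_mul, smul_eq_mul, ← map_smul, ← mk_mul, ← mk_mul, ← map_smul, smul_mul_assoc]

instance : SMulCommClass k (P.FreeAlg X) (P.FreeAlg X) where
  smul_comm c a b := by
    obtain ⟨a, rfl⟩ := mk_surjective a
    obtain ⟨b, rfl⟩ := mk_surjective b
    rw [smul_eq_mul, smul_eq_mul, ← map_smul, ← mk_mul, ← mk_mul, ← map_smul, mul_smul_comm]

/-- The quotient map as a homomorphism of algebras. -/
def mkHom : FreeNonUnitalNonAssocAlgebra k X →ₙₐ[k] P.FreeAlg X :=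
  { (mk : _ →ₗ[k] P.FreeAlg X) with
    map_zero' := map_zero mk
    map_mul' := mk_mul }

variable (P) in
/-- The free generators. -/
def gen (x : X) : P.FreeAlg X := mk (FreeNonUnitalNonAssocAlgebra.of k x)

end FreeAlg


section Lift

variable {P} {X : Type v} {A : Type w} [NonUnitalNonAssocRing A] [Module k A]

theorem map_eval {B : Type v} [NonUnitalNonAssocRing B] [Module k B]
    (f : B →ₙₐ[k] A) (a : Fin 3 → B) (r : Mag3 k) :
    f (Mag3.eval a r) = Mag3.eval (fun i => f (a i)) r := by
  simp [Mag3.eval, map_sum]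

theorem FreeAlg.isAlgebra : P.IsAlgebra (P.FreeAlg X) := by
  intro r hr a
  choose b hb using fun i => mk_surjective (a i)
  have h : Mag3.eval a r = mkHom (P := P) (Mag3.eval b r) := by
    rw [map_eval]
    exact congrArg (fun c => Mag3.eval c r) (funext fun i => (hb i).symm)
  rw [h]
  exact (Submodule.Quotient.mk_eq_zero _).2 (P.eval_mem_ideal hr b)

variable [IsScalarTower k A A] [SMulCommClass k A A]

theorem ideal_le_ker (hA : P.IsAlgebra A) (f : X → A) :
    P.idealOfIdentities X ≤
      LinearMap.ker ((FreeNonUnitalNonAssocAlgebra.lift k f : _ →ₙₐ[k] A) : _ →ₗ[k] A) := by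
  refine sInf_le ⟨fun r hr a => ?_, fun x y hy => ?_⟩
  · rw [LinearMap.mem_ker]
    exact (map_eval (FreeNonUnitalNonAssocAlgebra.lift k f) a r).trans (hA r hr _)
  · rw [LinearMap.mem_ker] at hy
    have hy' : FreeNonUnitalNonAssocAlgebra.lift k f y = 0 := hy
    constructor <;> rw [LinearMap.mem_ker]
    · exact (map_mul (FreeNonUnitalNonAssocAlgebra.lift k f) x y).trans (by rw [hy', mul_zero])
    · exact (map_mul (FreeNonUnitalNonAssocAlgebra.lift k f) y x).trans (by rw [hy', zero_mul])

/-- The universal property of the free `P`-algebra. -/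
def FreeAlg.lift (hA : P.IsAlgebra A) (f : X → A) : P.FreeAlg X →ₙₐ[k] A :=
  { (P.idealOfIdentities X).liftQ _ (ideal_le_ker hA f) with
    map_zero' := map_zero ((P.idealOfIdentities X).liftQ _ (ideal_le_ker hA f))
    map_mul' := by
      intro a b
      obtain ⟨a, rfl⟩ := mk_surjective a
      obtain ⟨b, rfl⟩ := mk_surjective b
      exact map_mul (FreeNonUnitalNonAssocAlgebra.lift k f) a b }

theorem FreeAlg.lift_gen (hA : P.IsAlgebra A) (f : X → A) (x : X) :
    FreeAlg.lift hA f (gen P x) = f x :=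
  FreeNonUnitalNonAssocAlgebra.lift_of_apply k f x

theorem FreeAlg.hom_ext {f g : P.FreeAlg X →ₙₐ[k] A} (h : ∀ x, f (gen P x) = g (gen P x)) :
    f = g := by
  have h1 : f.comp mkHom = g.comp (mkHom (P := P) (X := X)) :=
    FreeNonUnitalNonAssocAlgebra.hom_ext k h
  refine NonUnitalAlgHom.ext fun a => ?_
  obtain ⟨a, rfl⟩ := mk_surjective a
  exact DFunLike.congr_fun h1 a

end Lift

end BinaryQuadraticOperad

/-! ### Symmetric operads -/

/-- A symmetric operad in vector spaces over `k`, indexed by finite sets: `obj I` is the space of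
operations whose inputs are labelled by `I`, and `comp f g` plugs `g i` into the input `i` of
`f`. -/
structure SymmetricOperad (k : Type u) [Field k] where
  obj : (I : Type) → [Finite I] → Type v
  [addCommGroup : ∀ (I : Type) [Finite I], AddCommGroup (obj I)]
  [module : ∀ (I : Type) [Finite I], Module k (obj I)]
  relabel : ∀ {I J : Type} [Finite I] [Finite J], (I ≃ J) → (obj I →ₗ[k] obj J)
  one : obj Unit
  comp : ∀ {I : Type} [Finite I] {J : I → Type} [∀ i, Finite (J i)],
    obj I →ₗ[k] MultilinearMap k (fun i => obj (J i)) (obj (Σ i, J i))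
  relabel_refl : ∀ {I : Type} [Finite I] (f : obj I), relabel (Equiv.refl I) f = f
  relabel_trans : ∀ {I J K : Type} [Finite I] [Finite J] [Finite K] (d : I ≃ J) (e : J ≃ K)
    (f : obj I), relabel (d.trans e) f = relabel e (relabel d f)
  comp_relabel_right : ∀ {I : Type} [Finite I] {J K : I → Type} [∀ i, Finite (J i)]
    [∀ i, Finite (K i)] (e : ∀ i, J i ≃ K i) (f : obj I) (g : ∀ i, obj (J i)),
    comp f (fun i => relabel (e i) (g i)) = relabel (Equiv.sigmaCongrRight e) (comp f g)
  comp_relabel_left : ∀ {I I' : Type} [Finite I] [Finite I'] {J : I' → Type}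
    [∀ i, Finite (J i)] (e : I ≃ I') (f : obj I) (g : ∀ i, obj (J i)),
    comp (relabel e f) g = relabel (Equiv.sigmaCongrLeft e) (comp f (fun i => g (e i)))
  one_comp : ∀ {I : Type} [Finite I] (g : obj I),
    comp one (fun _ => g) = relabel (Equiv.uniqueSigma (fun _ : Unit => I)).symm g
  comp_one : ∀ {I : Type} [Finite I] (f : obj I),
    comp f (fun _ => one) = relabel (Equiv.sigmaPUnit I).symm f
  assoc : ∀ {I : Type} [Finite I] {J : I → Type} [∀ i, Finite (J i)] {K : ∀ i, J i → Type}
    [∀ i j, Finite (K i j)] (f : obj I) (g : ∀ i, obj (J i)) (h : ∀ i j, obj (K i j)),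
    relabel (Equiv.sigmaAssoc K) (comp (comp f g) (fun p => h p.1 p.2)) =
      comp f (fun i => comp (g i) (h i))

attribute [instance] SymmetricOperad.addCommGroup SymmetricOperad.module

/-- An isomorphism of symmetric operads. -/
structure SymmetricOperad.Iso {k : Type u} [Field k] (P : SymmetricOperad.{u, v} k)
    (Q : SymmetricOperad.{u, w} k) where
  toEquiv : (I : Type) → [Finite I] → (P.obj I ≃ₗ[k] Q.obj I)
  map_relabel : ∀ {I J : Type} [Finite I] [Finite J] (e : I ≃ J) (f : P.obj I),
    toEquiv J (P.relabel e f) = Q.relabel e (toEquiv I f)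
  map_one : toEquiv Unit P.one = Q.one
  map_comp : ∀ {I : Type} [Finite I] {J : I → Type} [∀ i, Finite (J i)] (f : P.obj I)
    (g : ∀ i, P.obj (J i)),
    toEquiv (Σ i, J i) (P.comp f g) = Q.comp (toEquiv I f) (fun i => toEquiv (J i) (g i))

namespace BinaryQuadraticOperad

/-! ### The symmetric operad of multilinear elements of free algebras -/

/-- The multiset of leaves of a binary tree. -/
def leaves {X : Type v} : FreeMagma X → Multiset X
  | .of x => {x}
  | .mul a b => leaves a + leaves b

theorem leaves_of {X : Type v} (x : X) : leaves (FreeMagma.of x) = {x} := rfl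

theorem leaves_mul {X : Type v} (a b : FreeMagma X) : leaves (a * b) = leaves a + leaves b := rfl

section Tree

variable {k : Type u} [Field k] {P : BinaryQuadraticOperad k} {X : Type v} {A : Type w}
  [NonUnitalNonAssocRing A] [Module k A]

theorem map_tree {B : Type*} [NonUnitalNonAssocRing B] [Module k B] (f : A →ₙₐ[k] B) (a : X → A)
    (t : FreeMagma X) : f (FreeMagma.lift a t) = FreeMagma.lift (fun x => f (a x)) t := by
  induction t using FreeMagma.recOnMul with
  | ih1 x => rfl
  | ih2 s t hs ht => rw [map_mul, map_mul, map_mul, hs, ht]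

theorem tree_congr {a b : X → A} {t : FreeMagma X} (h : ∀ x ∈ leaves t, a x = b x) :
    FreeMagma.lift a t = FreeMagma.lift b t := by
  induction t using FreeMagma.recOnMul with
  | ih1 x => exact h x (by simp [leaves_of])
  | ih2 s t hs ht =>
    rw [map_mul, map_mul, hs fun x hx => h x (by simp [leaves_mul, hx]),
      ht fun x hx => h x (by simp [leaves_mul, hx])]

theorem tree_update_add [DecidableEq X] (a : X → A) {t : FreeMagma X} (ht : (leaves t).Nodup)
    {x : X} (hx : x ∈ leaves t) (b c : A) :
    FreeMagma.lift (Function.update a x (b + c)) t =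
      FreeMagma.lift (Function.update a x b) t + FreeMagma.lift (Function.update a x c) t := by
  induction t using FreeMagma.recOnMul with
  | ih1 y =>
    obtain rfl : x = y := by simpa [leaves_of] using hx
    simp
  | ih2 s t hs ht' =>
    rw [leaves_mul, Multiset.nodup_add] at ht
    obtain ⟨h1, h2, h3⟩ := ht
    have key : ∀ (r : FreeMagma X), x ∉ leaves r → ∀ d e : A,
        FreeMagma.lift (Function.update a x d) r = FreeMagma.lift (Function.update a x e) r :=
      fun r hr d e => tree_congr fun y hy => by
        have : y ≠ x := fun h => hr (h ▸ hy)
        simp [this]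
    rw [leaves_mul, Multiset.mem_add] at hx
    rcases hx with hx | hx
    · have hn := Multiset.disjoint_left.1 h3 hx
      rw [map_mul, map_mul, map_mul, hs h1 hx, key t hn (b + c) b, key t hn c b, add_mul]
    · have hn := Multiset.disjoint_right.1 h3 hx
      rw [map_mul, map_mul, map_mul, ht' h2 hx, key s hn (b + c) b, key s hn c b, mul_add]

theorem tree_update_smul [IsScalarTower k A A] [SMulCommClass k A A] [DecidableEq X] (a : X → A)
    {t : FreeMagma X} (ht : (leaves t).Nodup) {x : X} (hx : x ∈ leaves t) (c : k) (b : A) :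
    FreeMagma.lift (Function.update a x (c • b)) t =
      c • FreeMagma.lift (Function.update a x b) t := by
  induction t using FreeMagma.recOnMul with
  | ih1 y =>
    obtain rfl : x = y := by simpa [leaves_of] using hx
    simp
  | ih2 s t hs ht' =>
    rw [leaves_mul, Multiset.nodup_add] at ht
    obtain ⟨h1, h2, h3⟩ := ht
    have key : ∀ (r : FreeMagma X), x ∉ leaves r → ∀ d e : A,
        FreeMagma.lift (Function.update a x d) r = FreeMagma.lift (Function.update a x e) r :=
      fun r hr d e => tree_congr fun y hy => by
        have : y ≠ x := fun h => hr (h ▸ hy)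
        simp [this]
    rw [leaves_mul, Multiset.mem_add] at hx
    rcases hx with hx | hx
    · have hn := Multiset.disjoint_left.1 h3 hx
      rw [map_mul, map_mul, hs h1 hx, key t hn (c • b) b, smul_mul_assoc]
    · have hn := Multiset.disjoint_right.1 h3 hx
      rw [map_mul, map_mul, ht' h2 hx, key s hn (c • b) b, mul_smul_comm]

end Tree

variable {k : Type u} [Field k] (P : BinaryQuadraticOperad k)

/-- The subspace of `P⟨X⟩` spanned by the tree monomials with prescribed multiset of leaves. -/
def weightSpace {X : Type v} (s : Multiset X) : Submodule k (P.FreeAlg X) :=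
  Submodule.span k {y | ∃ t : FreeMagma X, leaves t = s ∧ FreeMagma.lift (FreeAlg.gen P) t = y}

/-- The space of multilinear elements of `P⟨I⟩`: it is spanned by the tree monomials in which each
element of `I` occurs exactly once. -/
def multilinear (I : Type) : Submodule k (P.FreeAlg I) :=
  Submodule.span k {y | ∃ t : FreeMagma I, ((leaves t).Nodup ∧ ∀ i, i ∈ leaves t) ∧
    FreeMagma.lift (FreeAlg.gen P) t = y}

variable {P}

theorem gen_mem_weightSpace {X : Type v} (x : X) :
    FreeAlg.gen P x ∈ P.weightSpace ({x} : Multiset X) :=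
  Submodule.subset_span ⟨FreeMagma.of x, rfl, rfl⟩

theorem mul_mem_weightSpace {X : Type v} {s t : Multiset X} {a b : P.FreeAlg X}
    (ha : a ∈ P.weightSpace s) (hb : b ∈ P.weightSpace t) : a * b ∈ P.weightSpace (s + t) := by
  induction ha using Submodule.span_induction with
  | mem x hx =>
    obtain ⟨t1, rfl, rfl⟩ := hx
    induction hb using Submodule.span_induction with
    | mem y hy =>
      obtain ⟨t2, rfl, rfl⟩ := hy
      exact Submodule.subset_span ⟨t1 * t2, rfl, map_mul _ _ _⟩
    | zero => rw [mul_zero]; exact Submodule.zero_mem _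
    | add x y _ _ hx hy => rw [mul_add]; exact Submodule.add_mem _ hx hy
    | smul c x _ hx => rw [mul_smul_comm]; exact Submodule.smul_mem _ c hx
  | zero => rw [zero_mul]; exact Submodule.zero_mem _
  | add x y _ _ hx hy => rw [add_mul]; exact Submodule.add_mem _ hx hy
  | smul c x _ hx => rw [smul_mul_assoc]; exact Submodule.smul_mem _ c hx

theorem tree_mem_weightSpace {X : Type v} {Y : Type w} {a : X → P.FreeAlg Y} {s : X → Multiset Y}
    (ha : ∀ x, a x ∈ P.weightSpace (s x)) (t : FreeMagma X) :
    FreeMagma.lift a t ∈ P.weightSpace ((leaves t).bind s) := by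
  induction t using FreeMagma.recOnMul with
  | ih1 x => simpa [leaves_of] using ha x
  | ih2 p q hp hq =>
    rw [map_mul, leaves_mul, Multiset.add_bind]
    exact mul_mem_weightSpace hp hq

theorem lift_tree {X : Type v} {Y : Type w} (a : X → P.FreeAlg Y) (t : FreeMagma X) :
    FreeAlg.lift FreeAlg.isAlgebra a (FreeMagma.lift (FreeAlg.gen P) t) = FreeMagma.lift a t := by
  rw [map_tree]
  simp only [FreeAlg.lift_gen]

theorem lift_mem_weightSpace {X : Type v} {Y : Type w} {a : X → P.FreeAlg Y} {s : X → Multiset Y}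
    (ha : ∀ x, a x ∈ P.weightSpace (s x)) {m : Multiset X} {f : P.FreeAlg X}
    (hf : f ∈ P.weightSpace m) :
    FreeAlg.lift FreeAlg.isAlgebra a f ∈ P.weightSpace (m.bind s) := by
  induction hf using Submodule.span_induction with
  | mem x hx =>
    obtain ⟨t, rfl, rfl⟩ := hx
    rw [lift_tree]
    exact tree_mem_weightSpace ha t
  | zero => rw [map_zero]; exact Submodule.zero_mem _
  | add x y _ _ hx hy => rw [map_add]; exact Submodule.add_mem _ hx hy
  | smul c x _ hx => rw [map_smul]; exact Submodule.smul_mem _ c hx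

theorem multilinear_eq {I : Type} {s : Multiset I} (hs : s.Nodup) (hm : ∀ i, i ∈ s) :
    P.multilinear I = P.weightSpace s := by
  unfold multilinear weightSpace
  congr 1
  ext y
  refine exists_congr fun t => and_congr_left fun _ => ⟨fun h => ?_, fun h => ?_⟩
  · exact (Multiset.Nodup.ext h.1 hs).2 fun i => by simp [h.2, hm]
  · exact h ▸ ⟨hs, hm⟩

theorem exists_multiset (I : Type) [Finite I] : ∃ s : Multiset I, s.Nodup ∧ ∀ i, i ∈ s := by
  have := Fintype.ofFinite I
  exact ⟨Finset.univ.val, Finset.univ.nodup, fun i => Finset.mem_univ_val i⟩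

variable (P) in
/-- The homomorphism of free algebras induced by a map of generators. -/
def rename {X : Type v} {Y : Type w} (e : X → Y) : P.FreeAlg X →ₙₐ[k] P.FreeAlg Y :=
  FreeAlg.lift FreeAlg.isAlgebra (fun x => FreeAlg.gen P (e x))

theorem rename_mem_weightSpace {X : Type v} {Y : Type w} (e : X → Y) {s : Multiset X}
    {f : P.FreeAlg X} (hf : f ∈ P.weightSpace s) : P.rename e f ∈ P.weightSpace (s.map e) := by
  rw [← Multiset.bind_singleton]
  exact lift_mem_weightSpace (fun x => gen_mem_weightSpace (e x)) hf

theorem rename_mem_multilinear {I J : Type} [Finite I] (e : I ≃ J) {f : P.FreeAlg I}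
    (hf : f ∈ P.multilinear I) : P.rename e f ∈ P.multilinear J := by
  obtain ⟨s, hs, hm⟩ := exists_multiset I
  rw [multilinear_eq hs hm] at hf
  rw [multilinear_eq (s := s.map e) (hs.map e.injective)
    fun j => Multiset.mem_map.2 ⟨e.symm j, hm _, e.apply_symm_apply j⟩]
  exact rename_mem_weightSpace e hf

variable (P) in
/-- Substitution of elements of free algebras for the generators, the variables of different
substituted elements being made different. -/
def substitute {I : Type} {J : I → Type} (g : ∀ i, P.FreeAlg (J i)) :
    P.FreeAlg I →ₙₐ[k] P.FreeAlg (Σ i, J i) :=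
  FreeAlg.lift FreeAlg.isAlgebra (fun i => P.rename (Sigma.mk i) (g i))

theorem substitute_mem_multilinear {I : Type} [Finite I] {J : I → Type} [∀ i, Finite (J i)]
    {f : P.FreeAlg I} (hf : f ∈ P.multilinear I) {g : ∀ i, P.FreeAlg (J i)}
    (hg : ∀ i, g i ∈ P.multilinear (J i)) : P.substitute g f ∈ P.multilinear (Σ i, J i) := by
  obtain ⟨s, hs, hm⟩ := exists_multiset I
  choose t ht hn using fun i => exists_multiset (J i)
  rw [multilinear_eq hs hm] at hf
  simp only [multilinear_eq (ht _) (hn _)] at hg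
  rw [multilinear_eq (s := s.sigma t) (hs.sigma ht)
    fun p => Multiset.mem_sigma.2 ⟨hm _, hn _ _⟩]
  exact lift_mem_weightSpace (fun i => rename_mem_weightSpace (Sigma.mk i) (hg i)) hf

theorem substitute_update_add {I : Type} {J : I → Type} [DecidableEq I] {f : P.FreeAlg I}
    (hf : f ∈ P.multilinear I) (g : ∀ i, P.FreeAlg (J i)) (i : I) (a b : P.FreeAlg (J i)) :
    P.substitute (Function.update g i (a + b)) f =
      P.substitute (Function.update g i a) f + P.substitute (Function.update g i b) f := by
  have key : ∀ c : P.FreeAlg (J i), (fun j => P.rename (Sigma.mk j) (Function.update g i c j)) =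
      Function.update (fun j => P.rename (Sigma.mk j) (g j)) i (P.rename (Sigma.mk i) c) := by
    intro c
    funext j
    rcases eq_or_ne j i with rfl | h
    · simp
    · simp [h]
  simp only [substitute, key, map_add]
  induction hf using Submodule.span_induction with
  | mem x hx =>
    obtain ⟨t, ht, rfl⟩ := hx
    simp only [lift_tree]
    exact tree_update_add _ ht.1 (ht.2 i) _ _
  | zero => simp only [map_zero, add_zero]
  | add x y _ _ hx hy => simp only [map_add, hx, hy]; abel
  | smul c x _ hx => simp only [map_smul, hx, smul_add]

theorem substitute_update_smul {I : Type} {J : I → Type} [DecidableEq I] {f : P.FreeAlg I}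
    (hf : f ∈ P.multilinear I) (g : ∀ i, P.FreeAlg (J i)) (i : I) (c : k) (a : P.FreeAlg (J i)) :
    P.substitute (Function.update g i (c • a)) f =
      c • P.substitute (Function.update g i a) f := by
  have key : ∀ c : P.FreeAlg (J i), (fun j => P.rename (Sigma.mk j) (Function.update g i c j)) =
      Function.update (fun j => P.rename (Sigma.mk j) (g j)) i (P.rename (Sigma.mk i) c) := by
    intro c
    funext j
    rcases eq_or_ne j i with rfl | h
    · simp
    · simp [h]
  simp only [substitute, key, map_smul]
  induction hf using Submodule.span_induction with
  | mem x hx =>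
    obtain ⟨t, ht, rfl⟩ := hx
    simp only [lift_tree]
    exact tree_update_smul _ ht.1 (ht.2 i) _ _
  | zero => simp only [map_zero, smul_zero]
  | add x y _ _ hx hy => simp only [map_add, hx, hy, smul_add]
  | smul d x _ hx => simp only [map_smul, hx]; rw [smul_comm]

theorem rename_gen {X : Type v} {Y : Type w} (e : X → Y) (x : X) :
    P.rename e (FreeAlg.gen P x) = FreeAlg.gen P (e x) := FreeAlg.lift_gen _ _ _

theorem substitute_gen {I : Type} {J : I → Type} (g : ∀ i, P.FreeAlg (J i)) (i : I) :
    P.substitute g (FreeAlg.gen P i) = P.rename (Sigma.mk i) (g i) := FreeAlg.lift_gen _ _ _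

theorem rename_rename {X Y Z : Type} (d : X → Y) (e : Y → Z) (f : P.FreeAlg X) :
    P.rename e (P.rename d f) = P.rename (fun x => e (d x)) f := by
  have h : (P.rename e).comp (P.rename d) = P.rename (fun x => e (d x)) :=
    FreeAlg.hom_ext fun x => by simp [rename_gen]
  exact DFunLike.congr_fun h f

variable (P) in
/-- Renaming of inputs of multilinear elements. -/
def relabelMultilinear {I J : Type} [Finite I] (e : I ≃ J) :
    P.multilinear I →ₗ[k] P.multilinear J where
  toFun f := ⟨P.rename e f, rename_mem_multilinear e f.2⟩
  map_add' _ _ := Subtype.ext (map_add _ _ _)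
  map_smul' _ _ := Subtype.ext (map_smul _ _ _)

variable (P) in
/-- Composition of multilinear elements. -/
def compMultilinear {I : Type} [Finite I] {J : I → Type} [∀ i, Finite (J i)] :
    P.multilinear I →ₗ[k]
      MultilinearMap k (fun i => P.multilinear (J i)) (P.multilinear (Σ i, J i)) where
  toFun f :=
    { toFun := fun g => ⟨P.substitute (fun i => (g i : P.FreeAlg (J i))) f,
        substitute_mem_multilinear f.2 fun i => (g i).2⟩
      map_update_add' := fun g i a b => Subtype.ext (by
        have := substitute_update_add f.2 (fun j => (g j : P.FreeAlg (J j))) i a b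
        simp only [Function.apply_update (fun j (c : P.multilinear (J j)) => (c : P.FreeAlg (J j)))]
        exact this)
      map_update_smul' := fun g i c a => Subtype.ext (by
        have := substitute_update_smul f.2 (fun j => (g j : P.FreeAlg (J j))) i c a
        simp only [Function.apply_update (fun j (c : P.multilinear (J j)) => (c : P.FreeAlg (J j)))]
        exact this) }
  map_add' _ _ := MultilinearMap.ext fun _ => Subtype.ext (map_add _ _ _)
  map_smul' _ _ := MultilinearMap.ext fun _ => Subtype.ext (map_smul _ _ _)

variable (P) in
/-- The symmetric operad presented by `P`: its operations with inputs labelled by `I` are the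
multilinear elements of the free algebra `P⟨I⟩`, and its composition is substitution. -/
def toSymmetricOperad : SymmetricOperad.{u, u} k where
  obj I _ := P.multilinear I
  addCommGroup _ _ := inferInstance
  module _ _ := inferInstance
  relabel e := P.relabelMultilinear e
  one := ⟨FreeAlg.gen P (), Submodule.subset_span ⟨FreeMagma.of (), by simp [leaves_of], rfl⟩⟩
  comp := P.compMultilinear
  relabel_refl {I _} f := Subtype.ext (by
    have h : P.rename (Equiv.refl I) = NonUnitalAlgHom.id k (P.FreeAlg I) :=
      FreeAlg.hom_ext fun x => rename_gen _ x
    exact DFunLike.congr_fun h f.1)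
  relabel_trans d e f := Subtype.ext (rename_rename d e f.1).symm
  comp_relabel_right e f g := Subtype.ext (by
    have h : P.substitute (fun i => P.rename (e i) (g i).1) =
        (P.rename (Equiv.sigmaCongrRight e)).comp (P.substitute fun i => (g i).1) :=
      FreeAlg.hom_ext fun i => by simp [substitute_gen, rename_rename]
    exact DFunLike.congr_fun h f.1)
  comp_relabel_left e f g := Subtype.ext (by
    have h : (P.substitute fun i => (g i).1).comp (P.rename e) =
        (P.rename (Equiv.sigmaCongrLeft e)).comp (P.substitute fun i => (g (e i)).1) :=
      FreeAlg.hom_ext fun i => by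
        simp [substitute_gen, rename_gen, rename_rename, Equiv.sigmaCongrLeft]
    exact DFunLike.congr_fun h f.1)
  one_comp g := Subtype.ext (substitute_gen (P := P) (fun _ : Unit => g.1) ())
  comp_one {I _} f := Subtype.ext (by
    have h : P.substitute (fun _ : I => FreeAlg.gen P ()) = P.rename (Equiv.sigmaPUnit I).symm :=
      FreeAlg.hom_ext fun i => by
        rw [substitute_gen, rename_gen, rename_gen]
        rfl
    exact DFunLike.congr_fun h f.1)
  assoc {I _ J _ K _} f g h := Subtype.ext (by
    have h1 : ((P.rename (Equiv.sigmaAssoc K)).comp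
        (P.substitute fun p : (Σ i, J i) => (h p.1 p.2).1)).comp (P.substitute fun i => (g i).1) =
        P.substitute (fun i => P.substitute (fun j => (h i j).1) (g i).1) := by
      refine FreeAlg.hom_ext fun i => ?_
      have h2 : ((P.rename (Equiv.sigmaAssoc K)).comp
          (P.substitute fun p : (Σ i, J i) => (h p.1 p.2).1)).comp (P.rename (Sigma.mk i)) =
          (P.rename (Sigma.mk i)).comp (P.substitute fun j => (h i j).1) :=
        FreeAlg.hom_ext fun j => by
          simp only [NonUnitalAlgHom.comp_apply, substitute_gen, rename_gen, rename_rename]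
          rfl
      simp only [NonUnitalAlgHom.comp_apply, substitute_gen]
      exact DFunLike.congr_fun h2 (g i).1
    exact DFunLike.congr_fun h1 f.1)

end BinaryQuadraticOperad

/-! ### Formal distributions and the Dong property -/

/-- A two-variable formal distribution `∑ F i j w^i z^j` multiplied by `w - z`. -/
def mulSub {A : Type w} [AddCommGroup A] (F : ℤ → ℤ → A) : ℤ → ℤ → A :=
  fun i j => F (i - 1) j - F i (j - 1)

/-- The product `a(w) b(z)` of formal distributions `a(w) = ∑ a i w^i` and `b(z) = ∑ b j z^j`. -/
def distMul {A : Type w} [Mul A] (a b : ℤ → A) : ℤ → ℤ → A := fun i j => a i * b j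

/-- `a(w) b(z) (w - z)^N = 0` for some `N`. -/
def IsLocalPair {A : Type w} [NonUnitalNonAssocRing A] (a b : ℤ → A) : Prop :=
  ∃ N : ℕ, mulSub^[N] (distMul a b) = 0

/-- Mutual locality of formal distributions with coefficients in a nonassociative algebra. -/
def MutuallyLocal {A : Type w} [NonUnitalNonAssocRing A] (a b : ℤ → A) : Prop :=
  IsLocalPair a b ∧ IsLocalPair b a

/-- The `n`-th product `(a_(n) b)(z) = Res_w (w - z)^n a(w) b(z)`, where `Res_w` is the coefficient
of `w^{-1}`. -/
def nthProduct {A : Type w} [NonUnitalNonAssocRing A] (n : ℕ) (a b : ℤ → A) : ℤ → A :=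
  fun j => mulSub^[n] (distMul a b) (-1) j

/-- The Dong property: the analogue of the Dong Lemma holds for all `P`-algebras. -/
def BinaryQuadraticOperad.DongProperty {k : Type u} [Field k] (P : BinaryQuadraticOperad k) :
    Prop :=
  ∀ (A : Type w) [NonUnitalNonAssocRing A] [Module k A] [IsScalarTower k A A]
    [SMulCommClass k A A], P.IsAlgebra A →
    ∀ a b c : ℤ → A, MutuallyLocal a b → MutuallyLocal b c → MutuallyLocal a c →
      ∀ n : ℕ, MutuallyLocal (nthProduct n a b) c

end

/-! Self-duality. The relations of BiCom are the tensors antisymmetric under exchange of the last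
two arguments on left-normed monomials, and of the first two on right-normed ones. Since the pairing
carries `sgn σ`, orthogonality to a difference `e_σ - e_{σs}`, with `s` the transposition, reads
`q(σ) + q(σs) = 0`, which is the same antisymmetry. So the relation space is its own orthogonal
complement (`dual_biCom`), and the operads agree by the identity.

Independence. In a bicommutative algebra `(ab)c` still remembers its leftmost letter and `c(ab)` its
rightmost one. A six-dimensional bicommutative algebra that records exactly these letters separates
the four monomials (`linearIndependent_biCom_monomials`).

Dong property. Write `x, y, z` for the variables of `a, b, c`. The product `(a(x)b(y))c(z)` is
killed by a power of `x - y`, and, being equal to `(a(x)c(z))b(y)`, by a power of `x - z`; hence a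
power of `y - z = (x - z) - (x - y)` kills it. On the other side, `c(z)(a(x)b(y)) = a(x)(c(z)b(y))`
is killed by a power of `z - y` at once. Multiplication by `(x - y)^n` commutes with these
operators, and taking the residue in `x` gives both halves of locality. -/

open Equiv in
theorem Equiv.Perm.sum_eq_zero_of_mul_swap {α M : Type*} [Fintype α] [DecidableEq α]
    [AddCommMonoid M] {i j : α} (hij : i ≠ j) (f : Perm α → M)
    (hf : ∀ σ, f σ + f (σ * swap i j) = 0) : ∑ σ, f σ = 0 := by
  refine Finset.sum_involution (fun σ _ => σ * swap i j) (fun σ _ => hf σ) (fun σ _ _ h => ?_)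
    (fun _ _ => Finset.mem_univ _) (fun σ _ => by simp [mul_assoc])
  exact hij (swap_eq_one_iff.1 (mul_eq_left.1 h))

/-! ### Pairing and evaluation on differences of monomials -/

namespace Mag3

variable {k : Type u} [Field k]

/-- The transposition reverses `sgn σ`, which turns the difference of monomials into a sum of
coefficients. -/
theorem pairing_leftMonomial_sub (q : Mag3 k) (σ : Equiv.Perm (Fin 3)) :
    pairing q (leftMonomial σ - leftMonomial (σ * Equiv.swap 1 2)) =
      ((Equiv.Perm.sign σ : ℤ) : k) * (q.1 σ + q.1 (σ * Equiv.swap 1 2)) := by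
  simp [pairing, leftMonomial, mul_sub, Finset.sum_sub_distrib, Pi.single_apply, mul_add]

theorem pairing_rightMonomial_sub (q : Mag3 k) (σ : Equiv.Perm (Fin 3)) :
    pairing q (rightMonomial σ - rightMonomial (σ * Equiv.swap 0 1)) =
      -(((Equiv.Perm.sign σ : ℤ) : k) * (q.2 σ + q.2 (σ * Equiv.swap 0 1))) := by
  simp [pairing, rightMonomial, mul_sub, Finset.sum_sub_distrib, Pi.single_apply, mul_add]
  ring

theorem eval_leftMonomial_sub {A : Type v} [NonUnitalNonAssocRing A] [Module k A] (a : Fin 3 → A)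
    (σ τ : Equiv.Perm (Fin 3)) :
    eval a (leftMonomial σ - leftMonomial τ : Mag3 k) =
      (a (σ 0) * a (σ 1)) * a (σ 2) - (a (τ 0) * a (τ 1)) * a (τ 2) := by
  simp [eval, leftMonomial, sub_smul, Finset.sum_sub_distrib, Pi.single_apply]

theorem eval_rightMonomial_sub {A : Type v} [NonUnitalNonAssocRing A] [Module k A] (a : Fin 3 → A)
    (σ τ : Equiv.Perm (Fin 3)) :
    eval a (rightMonomial σ - rightMonomial τ : Mag3 k) =
      a (σ 0) * (a (σ 1) * a (σ 2)) - a (τ 0) * (a (τ 1) * a (τ 2)) := by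
  simp [eval, rightMonomial, sub_smul, Finset.sum_sub_distrib, Pi.single_apply]

end Mag3

/-! ### Relations of BiCom and self-duality -/

section BiCom

variable {k : Type u} [Field k]

theorem eq_neg_of_mem_biCom_rel {r : Mag3 k} (hr : r ∈ (biCom k).rel) (σ : Equiv.Perm (Fin 3)) :
    r.1 (σ * Equiv.swap 1 2) = -r.1 σ ∧ r.2 (σ * Equiv.swap 0 1) = -r.2 σ := by
  induction hr using Submodule.span_induction with
  | mem x hx =>
    rcases hx with ⟨τ, rfl⟩ | ⟨τ, rfl⟩
    · have h : σ * Equiv.swap 1 2 = τ ↔ σ = τ * Equiv.swap 1 2 := by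
        rw [← eq_mul_inv_iff_mul_eq, Equiv.swap_inv]
      simp [Mag3.leftMonomial, Pi.single_apply, h]
    · have h : σ * Equiv.swap 0 1 = τ ↔ σ = τ * Equiv.swap 0 1 := by
        rw [← eq_mul_inv_iff_mul_eq, Equiv.swap_inv]
      simp [Mag3.rightMonomial, Pi.single_apply, h]
  | zero => simp
  | add x y _ _ hx hy => simp [hx, hy, add_comm]
  | smul c x _ hx => simp [hx]

/-- Describes the span by linear equations, the form in which it can be compared with an orthogonal
complement. -/
theorem mem_biCom_rel [NeZero (2 : k)] {r : Mag3 k} : r ∈ (biCom k).rel ↔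
    ∀ σ, r.1 (σ * Equiv.swap 1 2) = -r.1 σ ∧ r.2 (σ * Equiv.swap 0 1) = -r.2 σ := by
  refine ⟨eq_neg_of_mem_biCom_rel, fun h => ?_⟩
  -- The coefficient of the sum at `ρ` is `r(ρ) - r(ρs) = 2 r(ρ)`: each generator is met twice up to
  -- sign, at `ρ` and at `ρs`, hence the factor `2⁻¹`.
  have key : r = (2⁻¹ : k) • (∑ σ : Equiv.Perm (Fin 3),
      (r.1 σ • (Mag3.leftMonomial σ - Mag3.leftMonomial (σ * Equiv.swap 1 2)) +
        r.2 σ • (Mag3.rightMonomial σ - Mag3.rightMonomial (σ * Equiv.swap 0 1)))) := by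
    have h2 : (2 : k) ≠ 0 := NeZero.ne 2
    have hc : ∀ (i j : Fin 3) (ρ σ : Equiv.Perm (Fin 3)),
        ρ = σ * Equiv.swap i j ↔ ρ * Equiv.swap i j = σ := fun i j ρ σ => by
      rw [← mul_inv_eq_iff_eq_mul, Equiv.swap_inv]
    refine Prod.ext (funext fun ρ => ?_) (funext fun ρ => ?_)
    · simp [Prod.fst_sum, Finset.sum_apply, Mag3.leftMonomial, Mag3.rightMonomial,
        Pi.single_apply, mul_sub, Finset.sum_sub_distrib, hc, h ρ]
      field_simp
      ring
    · simp [Prod.snd_sum, Finset.sum_apply, Mag3.leftMonomial, Mag3.rightMonomial,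
        Pi.single_apply, mul_sub, Finset.sum_sub_distrib, hc, h ρ]
      field_simp
      ring
  rw [key]
  refine Submodule.smul_mem _ _ (Submodule.sum_mem _ fun σ _ => Submodule.add_mem _ ?_ ?_)
  · exact Submodule.smul_mem _ _ (Submodule.subset_span (Or.inl ⟨σ, rfl⟩))
  · exact Submodule.smul_mem _ _ (Submodule.subset_span (Or.inr ⟨σ, rfl⟩))

theorem dual_biCom [NeZero (2 : k)] : (biCom k).dual = biCom k := by
  refine BinaryQuadraticOperad.ext (Submodule.ext fun q => ?_)
  rw [mem_biCom_rel]
  have hs : ∀ σ : Equiv.Perm (Fin 3), ((Equiv.Perm.sign σ : ℤ) : k) ≠ 0 := fun σ => by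
    rcases Int.units_eq_one_or (Equiv.Perm.sign σ) with h | h <;> simp [h]
  constructor
  · intro hq σ
    have h1 := hq _ (Submodule.subset_span (Or.inl ⟨σ, rfl⟩))
    have h2 := hq _ (Submodule.subset_span (Or.inr ⟨σ, rfl⟩))
    rw [Mag3.pairing_leftMonomial_sub] at h1
    rw [Mag3.pairing_rightMonomial_sub, neg_eq_zero] at h2
    exact ⟨eq_neg_of_add_eq_zero_right ((mul_eq_zero.1 h1).resolve_left (hs σ)),
      eq_neg_of_add_eq_zero_right ((mul_eq_zero.1 h2).resolve_left (hs σ))⟩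
  · intro hq r hr
    have hr := mem_biCom_rel.1 hr
    simp only [Mag3.pairing, mul_sub, Finset.sum_sub_distrib]
    -- Both `q` and `r` change sign under the transposition, so their product does not, while `sgn`
    -- does: the terms cancel in pairs.
    rw [Equiv.Perm.sum_eq_zero_of_mul_swap (i := 1) (j := 2) (by decide),
      Equiv.Perm.sum_eq_zero_of_mul_swap (i := 0) (j := 1) (by decide), sub_zero]
    · intro σ
      simp [hq σ, hr σ]
    · intro σ
      simp [hq σ, hr σ]

variable {A : Type v} [NonUnitalNonAssocRing A] [Module k A]

/-- Algebras over `biCom k` are the bicommutative algebras. -/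
theorem isAlgebra_biCom_iff : (biCom k).IsAlgebra A ↔
    (∀ a b c : A, (a * b) * c = (a * c) * b) ∧ ∀ a b c : A, a * (b * c) = b * (a * c) := by
  constructor
  · intro hA
    refine ⟨fun a b c => sub_eq_zero.1 ?_, fun a b c => sub_eq_zero.1 ?_⟩
    · have h := hA _ (Submodule.subset_span (Or.inl ⟨1, rfl⟩)) ![a, b, c]
      rw [Mag3.eval_leftMonomial_sub] at h
      simpa [Equiv.swap_apply_of_ne_of_ne] using h
    · have h := hA _ (Submodule.subset_span (Or.inr ⟨1, rfl⟩)) ![a, b, c]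
      rw [Mag3.eval_rightMonomial_sub] at h
      simpa [Equiv.swap_apply_of_ne_of_ne] using h
  · rintro ⟨hl, hr⟩ r hrel a
    have h := eq_neg_of_mem_biCom_rel hrel
    -- The terms at `σ` and `σs` have opposite coefficients and, by the identities, equal monomial
    -- values.
    rw [Mag3.eval, Finset.sum_add_distrib,
      Equiv.Perm.sum_eq_zero_of_mul_swap (i := 1) (j := 2) (by decide),
      Equiv.Perm.sum_eq_zero_of_mul_swap (i := 0) (j := 1) (by decide), add_zero]
    · intro σ
      simp [h σ, Equiv.swap_apply_of_ne_of_ne, hr (a (σ 1)) (a (σ 0))]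
    · intro σ
      simp [h σ, Equiv.swap_apply_of_ne_of_ne, hl (a (σ 0)) (a (σ 2))]

end BiCom

/-- The identity isomorphism of a symmetric operad. -/
def SymmetricOperad.Iso.refl {k : Type u} [Field k] (P : SymmetricOperad.{u, v} k) : P.Iso P where
  toEquiv I _ := LinearEquiv.refl k (P.obj I)
  map_relabel _ _ := rfl
  map_one := rfl
  map_comp _ _ := rfl

/-! ### A bicommutative algebra separating monomials of degree three -/

/-- The space `k⁶`, with the product `u * v = λ(v) T u + λ(u) S v`, where `λ` is the zeroth
coordinate, `T` shifts the coordinates along `1 → 2 → 3` and `S` along `1 → 4 → 5`. -/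
def BicommutativeModel (k : Type u) : Type u := Fin 6 → k

namespace BicommutativeModel

variable {k : Type u}

theorem ext {u v : BicommutativeModel k} (h0 : u 0 = v 0) (h1 : u 1 = v 1) (h2 : u 2 = v 2)
    (h3 : u 3 = v 3) (h4 : u 4 = v 4) (h5 : u 5 = v 5) : u = v :=
  funext fun i => by fin_cases i <;> assumption

variable [Field k]

instance : AddCommGroup (BicommutativeModel k) := inferInstanceAs (AddCommGroup (Fin 6 → k))

instance : Module k (BicommutativeModel k) := inferInstanceAs (Module k (Fin 6 → k))

instance : Mul (BicommutativeModel k) where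
  mul u v := ![0, 0, v 0 * u 1, v 0 * u 2, u 0 * v 1, u 0 * v 4]

theorem mul_apply (u v : BicommutativeModel k) : (u * v) 0 = 0 ∧ (u * v) 1 = 0 ∧
    (u * v) 2 = v 0 * u 1 ∧ (u * v) 3 = v 0 * u 2 ∧ (u * v) 4 = u 0 * v 1 ∧
    (u * v) 5 = u 0 * v 4 := ⟨rfl, rfl, rfl, rfl, rfl, rfl⟩

theorem add_apply (u v : BicommutativeModel k) (i : Fin 6) : (u + v) i = u i + v i := rfl

theorem zero_apply (i : Fin 6) : (0 : BicommutativeModel k) i = 0 := rfl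

theorem smul_apply (c : k) (u : BicommutativeModel k) (i : Fin 6) : (c • u) i = c * u i := rfl

instance : NonUnitalNonAssocRing (BicommutativeModel k) :=
  { (inferInstance : AddCommGroup (BicommutativeModel k)),
    (inferInstance : Mul (BicommutativeModel k)) with
    left_distrib := fun u v w => by
      apply ext <;> simp only [mul_apply, add_apply] <;> ring
    right_distrib := fun u v w => by
      apply ext <;> simp only [mul_apply, add_apply] <;> ring
    zero_mul := fun u => by apply ext <;> simp [mul_apply, zero_apply]
    mul_zero := fun u => by apply ext <;> simp [mul_apply, zero_apply] }

instance : IsScalarTower k (BicommutativeModel k) (BicommutativeModel k) where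
  smul_assoc c u v := by
    apply ext <;> simp only [mul_apply, smul_apply, smul_eq_mul] <;> ring

instance : SMulCommClass k (BicommutativeModel k) (BicommutativeModel k) where
  smul_comm c u v := by
    apply ext <;> simp only [mul_apply, smul_apply, smul_eq_mul] <;> ring

/-- As `λ` vanishes on products and `TS = ST = 0`, one has `(uv)w = λ(v)λ(w) T²u` and `u(vw) =
λ(u)λ(v) S²w`, which are symmetric in the required arguments. -/
theorem isAlgebra : (biCom k).IsAlgebra (BicommutativeModel k) := by
  refine isAlgebra_biCom_iff.2 ⟨fun u v w => ?_, fun u v w => ?_⟩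
  · apply ext <;> simp only [mul_apply] <;> ring
  · apply ext <;> simp only [mul_apply] <;> ring

/-- The element with the first two coordinates `1` and `p`. -/
def point (p : k) : BicommutativeModel k := ![1, p, 0, 0, 0, 0]

theorem point_apply (p : k) : point p 0 = 1 ∧ point p 1 = p ∧ point p 2 = 0 ∧ point p 4 = 0 :=
  ⟨rfl, rfl, rfl, rfl⟩

end BicommutativeModel

open BinaryQuadraticOperad in
theorem linearIndependent_biCom_monomials {k : Type u} [Field k] {X : Type v} {a b c : X}
    (hab : a ≠ b) (hac : a ≠ c) (hbc : b ≠ c) :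
    LinearIndependent k
      ![(FreeAlg.gen (biCom k) a * FreeAlg.gen (biCom k) b) * FreeAlg.gen (biCom k) c,
        (FreeAlg.gen (biCom k) b * FreeAlg.gen (biCom k) a) * FreeAlg.gen (biCom k) c,
        FreeAlg.gen (biCom k) c * (FreeAlg.gen (biCom k) a * FreeAlg.gen (biCom k) b),
        FreeAlg.gen (biCom k) c * (FreeAlg.gen (biCom k) b * FreeAlg.gen (biCom k) a)] := by
  classical
  rw [Fintype.linearIndependent_iff]
  intro g hg
  -- All generators have `λ = 1`, and only `y` has a nonzero first coordinate. Coordinate 3 of a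
  -- left-normed monomial then tests whether its leftmost letter is `y`, and coordinate 5 of a
  -- right-normed one whether its rightmost letter is `y`; each choice below isolates one
  -- coefficient.
  have key := fun (y : X) (i : Fin 6) => congrFun (congrArg (FreeAlg.lift
    BicommutativeModel.isAlgebra fun x => BicommutativeModel.point (if x = y then 1 else 0)) hg) i
  simp only [Fin.sum_univ_four, map_add, map_smul, map_mul, map_zero,
    BicommutativeModel.add_apply, BicommutativeModel.smul_apply,
    BicommutativeModel.zero_apply, Matrix.cons_val, FreeAlg.lift_gen] at key
  have h0 := key a 3
  have h1 := key b 3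
  have h2 := key b 5
  have h3 := key a 5
  simp [BicommutativeModel.mul_apply, BicommutativeModel.point_apply, hab, hab.symm, hac.symm,
    hbc.symm] at h0 h1 h2 h3
  intro i
  fin_cases i <;> assumption

/-! ### The Dong property -/

/-- In the binomial expansion of `(s - t)^(m + n)` every term contains `s` to a power at least `m`
or `t` to a power at least `n`. -/
theorem Commute.sub_pow_smul_eq_zero {R M : Type*} [Ring R] [AddCommGroup M] [Module R M]
    {s t : R} (h : Commute s t) {x : M} {m n : ℕ} (hs : s ^ m • x = 0) (ht : t ^ n • x = 0) :
    (s - t) ^ (m + n) • x = 0 := by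
  rw [sub_eq_add_neg, h.neg_right.add_pow, Finset.sum_smul]
  refine Finset.sum_eq_zero fun i _ => ?_
  rw [← (Nat.cast_commute _ _).eq, mul_smul]
  suffices (s ^ i * (-t) ^ (m + n - i)) • x = 0 by rw [this, smul_zero]
  rcases le_total m i with hi | hi
  · rw [(h.neg_right.pow_pow _ _).eq, ← Nat.sub_add_cancel hi, pow_add s, ← mul_assoc, mul_smul,
      hs, smul_zero]
  · rw [Nat.sub_add_comm hi, pow_add, neg_pow t n, ← mul_assoc, ← mul_assoc, mul_smul, ht,
      smul_zero]

/-! ### Distributions in two and three variables -/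

section Dong

/-- Applied to multiplication by a fixed coefficient, this carries two-variable locality over to
triple products. -/
theorem map_mulSub_iterate {A : Type v} {B : Type w} [AddCommGroup A] [AddCommGroup B]
    (φ : A →+ B) (n : ℕ) (F : ℤ → ℤ → A) (i j : ℤ) :
    φ (mulSub^[n] F i j) = mulSub^[n] (fun i j => φ (F i j)) i j := by
  induction n generalizing F with
  | zero => rfl
  | succ n ih =>
    rw [Function.iterate_succ_apply, Function.iterate_succ_apply, ih]
    exact congrArg (fun G => mulSub^[n] G i j) (funext fun i => funext fun j => map_sub φ _ _)

variable {A : Type w} [AddCommGroup A]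

/-- Multiplication of a three-variable formal distribution `∑ F i j l x^i y^j z^l` by the monomial
with exponents `d`. -/
def monomialMul (d : ℤ × ℤ × ℤ) : Module.End ℤ (ℤ → ℤ → ℤ → A) where
  toFun F i j l := F (i - d.1) (j - d.2.1) (l - d.2.2)
  map_add' _ _ := rfl
  map_smul' _ _ := rfl

theorem monomialMul_commute (d e : ℤ × ℤ × ℤ) :
    Commute (monomialMul d : Module.End ℤ (ℤ → ℤ → ℤ → A)) (monomialMul e) := by
  refine LinearMap.ext fun F => ?_
  funext i j l
  simp only [Module.End.mul_apply, monomialMul, LinearMap.coe_mk, AddHom.coe_mk]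
  simp only [sub_right_comm]

variable (A) in
/-- The difference of the monomials with exponents `d` and `e`, as a multiplication operator. -/
def binomialMul (d e : ℤ × ℤ × ℤ) : Module.End ℤ (ℤ → ℤ → ℤ → A) := monomialMul d - monomialMul e

theorem binomialMul_commute (c d e f : ℤ × ℤ × ℤ) :
    Commute (binomialMul A c d) (binomialMul A e f) :=
  ((monomialMul_commute c e).sub_left (monomialMul_commute d e)).sub_right
    ((monomialMul_commute c f).sub_left (monomialMul_commute d f))

/-- Iterated `mulSub` on slices with the third index frozen becomes a power in a ring of operators,
where commutation and the binomial theorem are available. -/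
theorem binomialMul_xy_pow (n : ℕ) (F : ℤ → ℤ → ℤ → A) (i j l : ℤ) :
    (binomialMul A (1, 0, 0) (0, 1, 0) ^ n) F i j l = mulSub^[n] (fun i j => F i j l) i j := by
  induction n generalizing F with
  | zero => rfl
  | succ n ih =>
    rw [pow_succ, Module.End.mul_apply, ih, Function.iterate_succ_apply]
    refine congrArg (fun G => mulSub^[n] G i j) (funext fun _ => funext fun _ => ?_)
    simp [binomialMul, monomialMul, mulSub]

theorem binomialMul_xz_pow (n : ℕ) (F : ℤ → ℤ → ℤ → A) (i j l : ℤ) :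
    (binomialMul A (1, 0, 0) (0, 0, 1) ^ n) F i j l = mulSub^[n] (fun i l => F i j l) i l := by
  induction n generalizing F with
  | zero => rfl
  | succ n ih =>
    rw [pow_succ, Module.End.mul_apply, ih, Function.iterate_succ_apply]
    refine congrArg (fun G => mulSub^[n] G i l) (funext fun _ => funext fun _ => ?_)
    simp [binomialMul, monomialMul, mulSub]

theorem binomialMul_yz_pow (n : ℕ) (F : ℤ → ℤ → ℤ → A) (i j l : ℤ) :
    (binomialMul A (0, 1, 0) (0, 0, 1) ^ n) F i j l = mulSub^[n] (F i) j l := by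
  induction n generalizing F with
  | zero => rfl
  | succ n ih =>
    rw [pow_succ, Module.End.mul_apply, ih, Function.iterate_succ_apply]
    refine congrArg (fun G => mulSub^[n] G j l) (funext fun _ => funext fun _ => ?_)
    simp [binomialMul, monomialMul, mulSub]

/-- If `(x - y)^m` and `(x - z)^n` annihilate a distribution, then so does `(y - z)^(n + m)`. -/
theorem binomialMul_yz_pow_eq_zero {m n : ℕ} {F : ℤ → ℤ → ℤ → A}
    (hm : (binomialMul A (1, 0, 0) (0, 1, 0) ^ m) F = 0)
    (hn : (binomialMul A (1, 0, 0) (0, 0, 1) ^ n) F = 0) :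
    (binomialMul A (0, 1, 0) (0, 0, 1) ^ (n + m)) F = 0 := by
  have h : binomialMul A (0, 1, 0) (0, 0, 1) =
      binomialMul A (1, 0, 0) (0, 0, 1) - binomialMul A (1, 0, 0) (0, 1, 0) := by
    simp only [binomialMul]; abel
  rw [← Module.End.smul_def] at hm hn ⊢
  rw [h]
  exact (binomialMul_commute _ _ _ _).sub_pow_smul_eq_zero hn hm

end Dong

/-! ### Locality of n-th products over bicommutative algebras -/

section Locality

variable {A : Type w} [NonUnitalNonAssocRing A]

theorem isLocalPair_nthProduct_left (hA : ∀ a b c : A, (a * b) * c = (a * c) * b) {a b c : ℤ → A}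
    (hab : IsLocalPair a b) (hac : IsLocalPair a c) (n : ℕ) :
    IsLocalPair (nthProduct n a b) c := by
  obtain ⟨M, hM⟩ := hab
  obtain ⟨N, hN⟩ := hac
  set F : ℤ → ℤ → ℤ → A := fun i j l => (a i * b j) * c l with hF
  have hxy : (binomialMul A (1, 0, 0) (0, 1, 0) ^ M) F = 0 := by
    funext i j l
    rw [binomialMul_xy_pow]
    have h := map_mulSub_iterate (AddMonoidHom.mulRight (c l)) M (distMul a b) i j
    rw [hM] at h
    exact h.symm.trans (map_zero _)
  -- The identity `(ab)c = (ac)b` places `a` next to `c`, so that their locality applies.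
  have hxz : (binomialMul A (1, 0, 0) (0, 0, 1) ^ N) F = 0 := by
    funext i j l
    rw [binomialMul_xz_pow]
    have h := map_mulSub_iterate (AddMonoidHom.mulRight (b j)) N (distMul a c) i l
    rw [hN] at h
    simp only [hF, hA (a _) (b _)]
    exact h.symm.trans (map_zero _)
  -- The residue in `x` is the slice at first index `-1`.
  have hG : distMul (nthProduct n a b) c =
      (binomialMul A (1, 0, 0) (0, 1, 0) ^ n) F (-1) := by
    funext j l
    rw [binomialMul_xy_pow]
    exact map_mulSub_iterate (AddMonoidHom.mulRight (c l)) n (distMul a b) (-1) j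
  refine ⟨N + M, ?_⟩
  funext j l
  rw [hG, ← binomialMul_yz_pow, ← Module.End.mul_apply,
    ((binomialMul_commute _ _ _ _).pow_pow _ _).eq, Module.End.mul_apply,
    binomialMul_yz_pow_eq_zero hxy hxz, map_zero]
  rfl

/-- The identity `c(ab) = a(cb)` puts `c` next to `b`, so the locality exponent of `c` and `b`
serves for every `n`, whatever `a` is. -/
theorem isLocalPair_nthProduct_right (hA : ∀ a b c : A, a * (b * c) = b * (a * c)) {b c : ℤ → A}
    (hcb : IsLocalPair c b) (a : ℤ → A) (n : ℕ) :
    IsLocalPair c (nthProduct n a b) := by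
  obtain ⟨N, hN⟩ := hcb
  -- Here the second variable belongs to `c` and the third to `b`, so the factor of the `n`-th
  -- product is the difference of the first and third variables.
  set F : ℤ → ℤ → ℤ → A := fun i l j => c l * (a i * b j) with hF
  have hyz : (binomialMul A (0, 1, 0) (0, 0, 1) ^ N) F = 0 := by
    funext i l j
    rw [binomialMul_yz_pow]
    have h := map_mulSub_iterate (AddMonoidHom.mulLeft (a i)) N (distMul c b) l j
    rw [hN] at h
    simp only [hF, hA (c _) (a _)]
    exact h.symm.trans (map_zero _)
  have hG : distMul c (nthProduct n a b) =
      (binomialMul A (1, 0, 0) (0, 0, 1) ^ n) F (-1) := by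
    funext l j
    rw [binomialMul_xz_pow]
    exact map_mulSub_iterate (AddMonoidHom.mulLeft (c l)) n (distMul a b) (-1) j
  refine ⟨N, ?_⟩
  funext l j
  rw [hG, ← binomialMul_yz_pow, ← Module.End.mul_apply,
    ((binomialMul_commute _ _ _ _).pow_pow _ _).eq, Module.End.mul_apply, hyz, map_zero]
  rfl

theorem dongProperty_biCom {k : Type u} [Field k] :
    BinaryQuadraticOperad.DongProperty.{u, w} (biCom k) := by
  intro A _ _ _ _ hA a b c hab hbc hac n
  obtain ⟨hl, hr⟩ := isAlgebra_biCom_iff.1 hA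
  exact ⟨isLocalPair_nthProduct_left hl hab.1 hac.1 n, isLocalPair_nthProduct_right hr hbc.2 a n⟩

end Locality

theorem mainTheorem7 (k : Type u) [Field k] [CharZero k] :
    ((biCom k).dual = biCom k ∧
      Nonempty ((biCom k).dual.toSymmetricOperad.Iso (biCom k).toSymmetricOperad)) ∧
    (∀ (X : Type v) (x : X → (biCom k).dual.FreeAlg X),
      x = BinaryQuadraticOperad.FreeAlg.gen (biCom k).dual →
      ∀ a b c : X, a ≠ b → a ≠ c → b ≠ c →
        LinearIndependent k
          ![(x a * x b) * x c, (x b * x a) * x c, x c * (x a * x b), x c * (x b * x a)]) ∧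
    BinaryQuadraticOperad.DongProperty.{u, w} (biCom k) := by
  -- Equality of the presentations reduces every claim about the dual to one about BiCom itself.
  rw [dual_biCom]
  refine ⟨⟨rfl, ⟨SymmetricOperad.Iso.refl _⟩⟩, ?_, dongProperty_biCom⟩
  rintro X x rfl a b c hab hac hbc
  exact linearIndependent_biCom_monomials hab hac hbc
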